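/- Let $n$ be a natural number, let $B=\{z\in\mathbb{C}^n : |z|<1\}$ be the Euclidean unit ball and $\Omega=\mathbb{C}^n\setminus\bar B$. For $0\le j\le 2n$, a $j$-current on an open set $U\subseteq\mathbb{C}^n$ is a continuous $\mathbb{C}$-linear form on the space (with its usual inductive limit topology) of smooth complex-valued differential $(2n-j)$-forms with compact support in $U$; its exterior derivative is given by $\langle dT,\varphi\rangle=(-1)^{j+1}\langle T,d\varphi\rangle$. A current $T$ on $\Omega$ is called extendable if there is a current $\check T$ on $\mathbb{C}^n$ with $\check T|_{\Omega}=T$. Let $\check{\mathcal D}'^{j}(\Omega)$ be the space of extendable $j$-currents on $\Omega$, and let $$\check H^j(\Omega)=\frac{\{T\in\check{\mathcal D}'^{j}(\Omega): dT=0\}}{d\,\check{\mathcal D}'^{j-1}(\Omega)}$$ be the $j$-th de Rham cohomology group of extendable currents. Then $$\check H^j(\Omega)=0\quad\text{for } 2\le j\le 2n-2 .$$ That is, for $2\le j\le 2n-2$, every extendable $j$-current $T$ on $\Omega$ with $dT=0$ is of the form $T=dS$ with $S$ an extendable $(j-1)$-current on $\Omega$. -/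

import Mathlib

open scoped Distributions

noncomputable section

namespace ExtendableCurrents

section General

-- `E` stands for a finite-dimensional real vector space of even dimension `N`; below it is `ℂⁿ`,
-- regarded as a real vector space of dimension `N = 2 n`.
variable {E : Type*} [NormedAddCommGroup E] [NormedSpace ℝ E]
  (Ω : TopologicalSpace.Opens E) (k : ℕ)

/-- Smooth complex-valued differential `k`-forms with compact support in the open set `Ω ⊆ E`,
with the usual inductive limit topology. -/
abbrev TestForm : Type _ :=
  𝓓(Ω, E [⋀^Fin k]→L[ℝ] ℂ)

variable (E) in
/-- The pointwise antisymmetrization in the definition of the exterior derivative, as a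
`ℂ`-linear map. -/
def alternatize :
    (E →L[ℝ] E [⋀^Fin k]→L[ℝ] ℂ) →L[ℂ] E [⋀^Fin (k + 1)]→L[ℝ] ℂ where
  toFun := ContinuousAlternatingMap.alternatizeUncurryFinCLM ℝ E ℂ
  map_add' := map_add _
  map_smul' c f := by
    ext v
    simp [ContinuousAlternatingMap.alternatizeUncurryFinCLM_apply,
      ContinuousAlternatingMap.alternatizeUncurryFin_apply, Finset.mul_sum]
  cont := (ContinuousAlternatingMap.alternatizeUncurryFinCLM ℝ E ℂ).continuous

/-- The exterior derivative on compactly supported smooth forms. -/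
def dForm : TestForm Ω k →L[ℂ] TestForm Ω (k + 1) :=
  TestFunction.postcompCLM (alternatize E k) ∘L TestFunction.fderivCLM ℂ ⊤ ⊤

theorem dForm_apply (φ : TestForm Ω k) (x : E) : dForm Ω k φ x = extDeriv φ x := by
  simp [dForm, alternatize, extDeriv]

/-- Currents of dimension `k`, that is of degree `N - k`, on the open set `Ω ⊆ E`: the continuous
linear forms on the space of test `k`-forms. -/
abbrev Current : Type _ :=
  TestForm Ω k →L[ℂ] ℂ

-- A shortcut to Mathlib's instance.
instance : AddCommGroup (Current Ω k) := ContinuousLinearMap.addCommGroup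

/-- The exterior derivative of currents. If `T` has degree `p` then `⟨dT, φ⟩ = (-1)^(p+1) ⟨T, dφ⟩`;
here `p = N - (k + 1)` with `N` even, so that the sign is `(-1)^k`. -/
def dCurrent : Current Ω (k + 1) →ₗ[ℂ] Current Ω k where
  toFun T := (-1 : ℂ) ^ k • (T ∘L dForm Ω k)
  map_add' S T := by ext φ; simp
  map_smul' c T := by ext φ; simp [mul_left_comm]

/-- The restriction to `Ω` of a current defined on all of `E`: it is evaluated on the
extensions by zero of the test forms on `Ω`. -/
def restrict : Current (⊤ : TopologicalSpace.Opens E) k →ₗ[ℂ] Current Ω k where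
  toFun T := T ∘L TestFunction.monoCLM ℂ
  map_add' _ _ := rfl
  map_smul' _ _ := rfl

/-- The space of extendable currents of dimension `k` on `Ω`: the restrictions to `Ω` of the
currents on `E`. -/
def extendable : Submodule ℂ (Current Ω k) :=
  LinearMap.range (restrict Ω k)

/-- The space of `d`-closed currents of dimension `k` on `Ω`; in dimension `0`, that is in the top
degree `N`, every current is closed. -/
def closedCurrents : (k : ℕ) → Submodule ℂ (Current Ω k)
  | 0 => ⊤
  | k + 1 => LinearMap.ker (dCurrent Ω k)

/-- The cocycles: extendable `d`-closed currents. -/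
def cocycles : Submodule ℂ (Current Ω k) :=
  extendable Ω k ⊓ closedCurrents Ω k

/-- The coboundaries: derivatives of extendable currents. -/
def coboundaries : Submodule ℂ (Current Ω k) :=
  (extendable Ω (k + 1)).map (dCurrent Ω k)

/-- The de Rham cohomology of the extendable currents on `Ω` in dimension `k`, that is in degree
`N - k`: extendable closed currents modulo derivatives of extendable currents. -/
abbrev CohomologyOfDim : Type _ :=
  cocycles Ω k ⧸ (coboundaries Ω k).submoduleOf (cocycles Ω k)

theorem dForm_dForm (φ : TestForm Ω k) : dForm Ω (k + 1) (dForm Ω k φ) = 0 := by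
  ext1 x
  have h : ((dForm Ω k φ : TestForm Ω (k + 1)) : E → _) = extDeriv φ :=
    funext (dForm_apply Ω k φ)
  have hs : minSmoothness ℝ 2 ≤ (((⊤ : ℕ∞)) : WithTop ℕ∞) := by
    rw [minSmoothness_of_isRCLikeNormedField]
    exact WithTop.coe_le_coe.2 le_top
  rw [dForm_apply, h, extDeriv_extDeriv φ.contDiff hs]
  rfl

theorem dCurrent_restrict (T : Current (⊤ : TopologicalSpace.Opens E) (k + 1)) :
    dCurrent Ω k (restrict Ω (k + 1) T) = restrict Ω k (dCurrent ⊤ k T) := by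
  ext φ
  have h : (TestFunction.monoCLM ℂ (dForm Ω k φ) : TestForm ⊤ (k + 1))
      = dForm ⊤ k (TestFunction.monoCLM ℂ φ) := by
    ext1 x
    have h' : ((TestFunction.monoCLM ℂ φ : TestForm ⊤ k) : E → _) = φ := by
      simp
    rw [dForm_apply, h']
    simp [dForm_apply]
  change (-1 : ℂ) ^ k * T (TestFunction.monoCLM ℂ (dForm Ω k φ)) =
    (-1 : ℂ) ^ k * T (dForm ⊤ k (TestFunction.monoCLM ℂ φ))
  rw [h]

theorem coboundaries_le_cocycles : coboundaries Ω k ≤ cocycles Ω k := by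
  rintro _ ⟨_, ⟨T, rfl⟩, rfl⟩
  refine ⟨⟨dCurrent ⊤ k T, (dCurrent_restrict Ω k T).symm⟩, ?_⟩
  cases k with
  | zero => trivial
  | succ k =>
    refine LinearMap.mem_ker.mpr ?_
    ext φ
    simp [dCurrent, dForm_dForm]

end General

/-- The complement of the closed unit ball in `ℂⁿ`, the norm being the Euclidean one. -/
def ballCompl (n : ℕ) : TopologicalSpace.Opens (EuclideanSpace ℂ (Fin n)) :=
  ⟨(Metric.closedBall 0 1)ᶜ, Metric.isClosed_closedBall.isOpen_compl⟩

/-- The `j`-th de Rham cohomology group of the extendable currents on the complement of the closed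
unit ball in `ℂⁿ`, for `j ≤ 2 n`: extendable closed currents of degree `j` (dimension `2 n - j`)
modulo derivatives of extendable currents of degree `j - 1` (dimension `2 n - j + 1`). -/
abbrev Cohomology (n j : ℕ) : Type :=
  CohomologyOfDim (ballCompl n) (2 * n - j)

end ExtendableCurrents

end

/-!
Let `T` be an extendable closed current on the complement `Ω` of the closed unit ball, of dimension
`p` with `2 ≤ p ≤ N - 2`, where `N = 2 n`, and extend it to a current on the whole space `E`, still
denoted by `T`. Its boundary `T ∘ d` need not vanish on `E`, but it is supported in the closed ball.
Two continuous homotopy operators on test forms, transposed to currents, settle the question.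

* The cone operator `C φ (x) = ι_x ∫₀¹ t^q φ(t x) dt`, cut off far away from the ball, satisfies
  `d C ψ + C d ψ = ψ` near the closed ball in positive degrees, and `C φ` vanishes on a ball around
  `0` as soon as `φ` does (`exists_cone_clm`). Hence `T ∘ d ∘ C` is supported in the closed ball and
  has the same boundary as `T`. This uses `p - 1 ≥ 1`. The difference `W = T - T ∘ d ∘ C` is closed
  on `E` and agrees with `T` on `Ω`.
* For compactly supported forms of degree less than `N` there is a homotopy operator `H` preserving
  compact supports, `d H φ + H d φ = φ` (`exists_homotopy`). Then `S = W ∘ H` is a primitive of `W`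
  on `E`, hence of `T` on `Ω` (`exists_primitive_outside_ball`). This uses `p < N`.

The operator `H` is built one basis vector `e` at a time, by integrating along the lines in the
direction `e`, with a correction that restores compact support (`fiberPrimitive`). The error term of
such a step has the form `ℓ ∧ ι_e β` with `ℓ` the coordinate form dual to `e`, so it has only those
components that involve `e` (`dForm_fiber_add`). After all basis vectors have been used, the only
components left are those that involve all of them, and these do not exist below the top degree.

All these operators consist in averaging a form over a family of homotheties or translations
depending on one real parameter and contracting the result with a compactly supported vector field.
Such operators are continuous on test forms because averaging commutes with differentiation up to
the weight, so that no derivative is lost (`norm_iteratedFDeriv_lineAverage_le`,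
`exists_contract_lineAverage_clm`).
-/

open scoped Distributions

noncomputable section

namespace ExtendableCurrents

open MeasureTheory Set TopologicalSpace ContinuousAlternatingMap
open scoped ContDiff

/-! ### Averages over one-parameter families of affine maps -/

section LineAverage
universe u
variable {E F : Type u} [NormedAddCommGroup E] [NormedSpace ℝ E]
  [NormedAddCommGroup F] [NormedSpace ℝ F]

/-- The average `x ↦ ∫ w(t) φ(c(t) x + t e) dμ(t)` of `φ` over a family of affine maps of `E`,
each of them a homothety composed with a translation in the direction `e`. -/
def lineAverage (μ : Measure ℝ) (w c : ℝ → ℝ) (e : E) (φ : E → F) (x : E) : F :=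
  ∫ t, w t • φ (c t • x + t • e) ∂μ

theorem ae_norm_mul_le_one {μ : Measure ℝ} {w c : ℝ → ℝ} (hw1 : ∀ᵐ t ∂μ, ‖w t‖ ≤ 1)
    (hc1 : ∀ᵐ t ∂μ, ‖c t‖ ≤ 1) :
    ∀ᵐ t ∂μ, ‖w t * c t‖ ≤ 1 := by
  filter_upwards [hw1, hc1] with t ht ht'
  rw [norm_mul]
  exact mul_le_one₀ ht (norm_nonneg _) ht'

variable {μ : Measure ℝ} [IsFiniteMeasure μ] {w c : ℝ → ℝ} {e : E} {φ : E → F}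

theorem integrable_lineAverage (hw : Continuous w) (hc : Continuous c)
    (hw1 : ∀ᵐ t ∂μ, ‖w t‖ ≤ 1) (hφ : Continuous φ) (hs : HasCompactSupport φ) (x : E) :
    Integrable (fun t ↦ w t • φ (c t • x + t • e)) μ := by
  obtain ⟨C, hC⟩ := hφ.bounded_above_of_compact_support hs
  refine Integrable.of_bound (C := 1 * C) ?_ ?_
  · exact Continuous.aestronglyMeasurable (by fun_prop)
  · filter_upwards [hw1] with t ht
    rw [norm_smul]
    exact mul_le_mul ht (hC _) (norm_nonneg _) zero_le_one

theorem norm_lineAverage_le (hw1 : ∀ᵐ t ∂μ, ‖w t‖ ≤ 1) {C : ℝ}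
    (hC : ∀ y, ‖φ y‖ ≤ C) (x : E) : ‖lineAverage μ w c e φ x‖ ≤ C * μ.real univ := by
  refine norm_integral_le_of_norm_le_const ?_
  filter_upwards [hw1] with t ht
  rw [norm_smul]
  simpa using mul_le_mul ht (hC _) (norm_nonneg _) zero_le_one

theorem lineAverage_comp_clm [CompleteSpace F] {G : Type*} [NormedAddCommGroup G] [NormedSpace ℝ G]
    [CompleteSpace G] (A : F →L[ℝ] G) (hw : Continuous w) (hc : Continuous c)
    (hw1 : ∀ᵐ t ∂μ, ‖w t‖ ≤ 1) (hφ : Continuous φ) (hs : HasCompactSupport φ) (x : E) :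
    ∫ t, w t • A (φ (c t • x + t • e)) ∂μ = A (lineAverage μ w c e φ x) := by
  rw [lineAverage, ← A.integral_comp_comm (integrable_lineAverage hw hc hw1 hφ hs x)]
  simp

theorem hasFDerivAt_lineAverage [CompleteSpace F] (hw : Continuous w) (hc : Continuous c)
    (hw1 : ∀ᵐ t ∂μ, ‖w t‖ ≤ 1) (hc1 : ∀ᵐ t ∂μ, ‖c t‖ ≤ 1) (hφ : ContDiff ℝ 1 φ)
    (hs : HasCompactSupport φ) (x : E) :
    HasFDerivAt (lineAverage μ w c e φ)
      (lineAverage μ (fun t ↦ w t * c t) c e (fderiv ℝ φ) x) x := by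
  have hD : Continuous (fderiv ℝ φ) := hφ.continuous_fderiv one_ne_zero
  obtain ⟨C, hC⟩ := hD.bounded_above_of_compact_support (hs.fderiv ℝ)
  refine hasFDerivAt_integral_of_dominated_of_fderiv_le (s := univ)
    (F' := fun x t ↦ (w t * c t) • fderiv ℝ φ (c t • x + t • e)) (bound := fun _ ↦ C)
    Filter.univ_mem ?_ (integrable_lineAverage hw hc hw1 hφ.continuous hs x) ?_ ?_
    (integrable_const C) ?_
  · exact .of_forall fun y ↦ Continuous.aestronglyMeasurable (by fun_prop)
  · exact Continuous.aestronglyMeasurable (by fun_prop)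
  · filter_upwards [hw1, hc1] with t ht ht' y _
    rw [norm_smul, norm_mul]
    have := mul_le_mul (mul_le_mul ht ht' (norm_nonneg _) zero_le_one) (hC (c t • y + t • e))
      (norm_nonneg _) (by norm_num)
    simpa using this
  · refine .of_forall fun t y _ ↦ ?_
    have h1 : HasFDerivAt (fun y : E ↦ c t • y + t • e) (c t • ContinuousLinearMap.id ℝ E) y :=
      ((hasFDerivAt_id y).const_smul (c t)).add_const _
    have h2 := ((hφ.differentiable one_ne_zero _).hasFDerivAt.comp y h1).const_smul (w t)
    exact h2.congr_fderiv (by ext v; simp [smul_smul])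

-- The induction replaces `F` by `E →L[ℝ] F`, so that both spaces have to live in one universe.
theorem contDiff_lineAverage_nat [CompleteSpace F] (hw : Continuous w) (hc : Continuous c)
    (hw1 : ∀ᵐ t ∂μ, ‖w t‖ ≤ 1) (hc1 : ∀ᵐ t ∂μ, ‖c t‖ ≤ 1) (n : ℕ) (hφ : ContDiff ℝ ∞ φ)
    (hs : HasCompactSupport φ) : ContDiff ℝ n (lineAverage μ w c e φ) := by
  have h1 : ∀ (F : Type u) [NormedAddCommGroup F] [NormedSpace ℝ F] [CompleteSpace F] (w : ℝ → ℝ)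
      (_ : Continuous w) (_ : ∀ᵐ t ∂μ, ‖w t‖ ≤ 1) (φ : E → F) (_ : ContDiff ℝ ∞ φ)
      (_ : HasCompactSupport φ), ContDiff ℝ n (lineAverage μ w c e φ) := by
    induction n with
    | zero =>
      intro F _ _ _ w hw hw1 φ hφ hs
      refine contDiff_zero.2 (continuous_iff_continuousAt.2 fun x ↦ ?_)
      exact (hasFDerivAt_lineAverage hw hc hw1 hc1 (hφ.of_le (by simp)) hs x).continuousAt
    | succ n ih =>
      intro F _ _ _ w hw hw1 φ hφ hs
      have hd := hasFDerivAt_lineAverage (e := e) hw hc hw1 hc1 (hφ.of_le (by simp)) hs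
      rw [Nat.cast_succ, contDiff_succ_iff_hasFDerivAt]
      refine ⟨_, ?_, hd⟩
      refine ih _ _ (hw.mul hc) (ae_norm_mul_le_one hw1 hc1) _ (hφ.fderiv_right (by simp))
        (hs.fderiv ℝ)
  exact h1 F w hw hw1 φ hφ hs

theorem contDiff_lineAverage [CompleteSpace F] (hw : Continuous w) (hc : Continuous c)
    (hw1 : ∀ᵐ t ∂μ, ‖w t‖ ≤ 1) (hc1 : ∀ᵐ t ∂μ, ‖c t‖ ≤ 1) (hφ : ContDiff ℝ ∞ φ)
    (hs : HasCompactSupport φ) : ContDiff ℝ ∞ (lineAverage μ w c e φ) :=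
  contDiff_infty.2 fun n ↦ contDiff_lineAverage_nat hw hc hw1 hc1 n hφ hs

theorem norm_iteratedFDeriv_lineAverage_le [CompleteSpace F] (hw : Continuous w)
    (hc : Continuous c) (hw1 : ∀ᵐ t ∂μ, ‖w t‖ ≤ 1) (hc1 : ∀ᵐ t ∂μ, ‖c t‖ ≤ 1) (i : ℕ)
    (hφ : ContDiff ℝ ∞ φ) (hs : HasCompactSupport φ) {C : ℝ}
    (hC : ∀ y, ‖iteratedFDeriv ℝ i φ y‖ ≤ C) (x : E) :
    ‖iteratedFDeriv ℝ i (lineAverage μ w c e φ) x‖ ≤ C * μ.real univ := by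
  have h1 : ∀ (F : Type u) [NormedAddCommGroup F] [NormedSpace ℝ F] [CompleteSpace F] (w : ℝ → ℝ)
      (_ : Continuous w) (_ : ∀ᵐ t ∂μ, ‖w t‖ ≤ 1) (φ : E → F) (_ : ContDiff ℝ ∞ φ)
      (_ : HasCompactSupport φ) (_ : ∀ y, ‖iteratedFDeriv ℝ i φ y‖ ≤ C),
      ‖iteratedFDeriv ℝ i (lineAverage μ w c e φ) x‖ ≤ C * μ.real univ := by
    clear! φ
    induction i with
    | zero =>
      intro F _ _ _ w hw hw1 φ hφ hs hC
      simp only [norm_iteratedFDeriv_zero] at hC ⊢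
      exact norm_lineAverage_le hw1 hC x
    | succ i ih =>
      intro F _ _ _ w hw hw1 φ hφ hs hC
      have hd : fderiv ℝ (lineAverage μ w c e φ) = _ := funext fun y ↦
        (hasFDerivAt_lineAverage (e := e) hw hc hw1 hc1 (hφ.of_le (by simp)) hs y).fderiv
      rw [← norm_iteratedFDeriv_fderiv, hd]
      refine ih _ _ (hw.mul hc) (ae_norm_mul_le_one hw1 hc1) _ (hφ.fderiv_right (by simp))
        (hs.fderiv ℝ) fun y ↦ ?_
      rw [norm_iteratedFDeriv_fderiv]
      exact hC y
  exact h1 F w hw hw1 φ hφ hs hC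

end LineAverage

/-! ### Continuous operators on test forms -/

section Operators
universe u
variable {E : Type u} [NormedAddCommGroup E] [NormedSpace ℝ E]

/-- An operator on functions that restricts, for every compact set `K`, to a continuous operator
from the test functions supported in `K` to those supported in some compact set `K'`, is a
continuous operator on test functions. -/
theorem exists_testFunction_clm {F F' : Type*} [NormedAddCommGroup F] [NormedSpace ℝ F]
    [NormedSpace ℂ F] [IsScalarTower ℝ ℂ F] [NormedAddCommGroup F'] [NormedSpace ℝ F']
    [NormedSpace ℂ F'] [IsScalarTower ℝ ℂ F'] (A : (E → F) → E → F')
    (h : ∀ K : Compacts E, ∃ (K' : Compacts E) (T : 𝓓_{K}(E, F) →L[ℂ] 𝓓_{K'}(E, F')),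
      ∀ φ : 𝓓_{K}(E, F), ⇑(T φ) = A φ) :
    ∃ P : 𝓓((⊤ : Opens E), F) →L[ℂ] 𝓓((⊤ : Opens E), F'), ∀ φ, ⇑(P φ) = A φ := by
  choose K' T hT using h
  let Φ (φ : 𝓓((⊤ : Opens E), F)) : 𝓓((⊤ : Opens E), F') :=
    (TestFunction.ofSupportedIn (subset_univ _) (T ⟨tsupport φ, φ.hasCompactSupport⟩
      (.of_support_subset φ.contDiff (subset_tsupport φ)))).copy (A φ) (by
        rw [TestFunction.coe_ofSupportedIn, hT]
        rfl)
  refine ⟨TestFunction.limitCLM ℂ Φ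
    (fun K _ ↦ TestFunction.ofSupportedInCLM ℂ (subset_univ _) ∘L T K) fun K _ f ↦ ?_, fun φ ↦ rfl⟩
  refine DFunLike.ext' ?_
  change A f = T K f
  rw [hT]

variable {μ : Measure ℝ} [IsFiniteMeasure μ] {w c : ℝ → ℝ} {e : E}

/-- Averaging over a family of affine maps and pairing with a compactly supported vector field is a
continuous operation on test functions: by Leibniz' rule, its derivatives of order `i` are bounded
by those of order at most `i`. -/
theorem exists_bilin_lineAverage_clm {F F' : Type u} [NormedAddCommGroup F] [NormedSpace ℝ F]
    [NormedSpace ℂ F] [IsScalarTower ℝ ℂ F] [CompleteSpace F] [NormedAddCommGroup F']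
    [NormedSpace ℝ F'] [NormedSpace ℂ F'] [IsScalarTower ℝ ℂ F'] (B : F →L[ℝ] E →L[ℝ] F')
    (hB : ∀ (a : ℂ) (f : F) (v : E), B (a • f) v = a • B f v)
    (hw : Continuous w) (hc : Continuous c)
    (hw1 : ∀ᵐ t ∂μ, ‖w t‖ ≤ 1) (hc1 : ∀ᵐ t ∂μ, ‖c t‖ ≤ 1) {g : E → E} (hg : ContDiff ℝ ∞ g)
    {K K' : Compacts E} (hgK : EqOn g 0 (K' : Set E)ᶜ) :
    ∃ T : 𝓓_{K}(E, F) →L[ℂ] 𝓓_{K'}(E, F'), ∀ φ : 𝓓_{K}(E, F),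
        ⇑(T φ) = fun x ↦ B (lineAverage μ w c e φ x) (g x) := by
  have hsm (φ : 𝓓_{K}(E, F)) : ContDiff ℝ ∞ (lineAverage μ w c e φ) :=
    contDiff_lineAverage hw hc hw1 hc1 φ.contDiff φ.hasCompactSupport
  have hint (φ : 𝓓_{K}(E, F)) (x : E) :=
    integrable_lineAverage (e := e) hw hc hw1 φ.continuous φ.hasCompactSupport x
  refine ⟨ContDiffMapSupportedIn.mkCLM ℂ (fun φ x ↦ B (lineAverage μ w c e φ x) (g x)) ?_ ?_ ?_ ?_
    ?_, fun φ ↦ rfl⟩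
  · intro φ ψ x
    have : lineAverage μ w c e (φ + ψ : 𝓓_{K}(E, F)) x =
        lineAverage μ w c e φ x + lineAverage μ w c e ψ x := by
      rw [lineAverage, lineAverage, lineAverage, ← integral_add (hint φ x) (hint ψ x)]
      simp
    rw [this]
    simp
  · intro a φ x
    have : lineAverage μ w c e (a • φ : 𝓓_{K}(E, F)) x = a • lineAverage μ w c e φ x := by
      rw [lineAverage, lineAverage, ← integral_smul]
      simp [smul_comm a]
    rw [this, hB]
  · intro φ
    exact B.isBoundedBilinearMap.contDiff.comp ((hsm φ).prodMk hg)
  · intro φ x hx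
    simp [hgK hx]
  · intro i _
    have hgs : HasCompactSupport g := .intro K'.isCompact hgK
    have hgi (j : ℕ) : ∃ C, ∀ x, ‖iteratedFDeriv ℝ j g x‖ ≤ C :=
      (hg.continuous_iteratedFDeriv (by exact_mod_cast le_top)).bounded_above_of_compact_support
        (hgs.iteratedFDeriv j)
    choose C hC using hgi
    have hC0 (j : ℕ) : 0 ≤ C j := (norm_nonneg _).trans (hC j 0)
    have hS : 0 ≤ ∑ j ∈ Finset.range (i + 1), (i.choose j : ℝ) * μ.real univ * C (i - j) :=
      Finset.sum_nonneg fun j _ ↦ mul_nonneg (by positivity) (hC0 _)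
    refine ⟨Finset.range (i + 1), ‖B‖ * ∑ j ∈ Finset.range (i + 1),
      (i.choose j : ℝ) * μ.real univ * C (i - j), mul_nonneg B.opNorm_nonneg hS, fun φ x _ ↦ ?_⟩
    refine (B.norm_iteratedFDeriv_le_of_bilinear (hsm φ) hg x (n := i)
      (by exact_mod_cast le_top)).trans ?_
    rw [mul_assoc, Finset.sum_mul]
    refine mul_le_mul_of_nonneg_left (Finset.sum_le_sum fun j hj ↦ ?_) B.opNorm_nonneg
    have h1 := norm_iteratedFDeriv_lineAverage_le (e := e) hw hc hw1 hc1 j φ.contDiff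
      φ.hasCompactSupport (fun y ↦
        (ContDiffMapSupportedIn.norm_iteratedFDeriv_apply_le_seminorm_top ℂ (x := y)).trans
          (Seminorm.le_finset_sup_apply hj)) x
    have h2 := mul_le_mul h1 (hC (i - j) x) (norm_nonneg _) ((norm_nonneg _).trans h1)
    rw [mul_assoc]
    exact (mul_le_mul_of_nonneg_left h2 (Nat.cast_nonneg _)).trans_eq (by ring)

/-- Averaging a `(q + 1)`-form over a family of affine maps and contracting the result with a
compactly supported vector field `g` is a continuous operation on test forms. -/
theorem exists_contract_lineAverage_clm {q : ℕ} (hw : Continuous w) (hc : Continuous c)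
    (hw1 : ∀ᵐ t ∂μ, ‖w t‖ ≤ 1) (hc1 : ∀ᵐ t ∂μ, ‖c t‖ ≤ 1) {g : E → E} (hg : ContDiff ℝ ∞ g)
    {K K' : Compacts E} (hgK : EqOn g 0 (K' : Set E)ᶜ) :
    ∃ T : 𝓓_{K}(E, E [⋀^Fin (q + 1)]→L[ℝ] ℂ) →L[ℂ] 𝓓_{K'}(E, E [⋀^Fin q]→L[ℝ] ℂ),
      ∀ φ : 𝓓_{K}(E, E [⋀^Fin (q + 1)]→L[ℝ] ℂ),
        ⇑(T φ) = fun x ↦ (lineAverage μ w c e φ x).curryLeft (g x) :=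
  exists_bilin_lineAverage_clm
    (ContinuousAlternatingMap.curryLeftLI (𝕜 := ℝ) (E := E) (F := ℂ)
      (n := q)).toContinuousLinearMap (fun _ _ _ ↦ rfl) hw hc hw1 hc1 hg hgK

end Operators

/-! ### The cone operator -/

section Cone
universe u
variable {E : Type u} [NormedAddCommGroup E] [NormedSpace ℝ E]

/-- The algebraic core of Cartan's formula: contraction with `v` is an antiderivation. Here `A'` is
the contraction of the values of `A` with `v`. -/
theorem curryLeft_alternatizeUncurryFin_add {q : ℕ} (A : E →L[ℝ] E [⋀^Fin (q + 1)]→L[ℝ] ℂ)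
    (A' : E →L[ℝ] E [⋀^Fin q]→L[ℝ] ℂ) (v : E) (hA : ∀ h, A' h = (A h).curryLeft v) :
    (alternatizeUncurryFin A).curryLeft v + alternatizeUncurryFin A' = A v := by
  ext u
  have hcons (i : Fin (q + 1)) : Fin.removeNth i.succ (Matrix.vecCons v u) =
      Matrix.vecCons v (Fin.removeNth i u) := Fin.cons_comp_succ_succAbove _ _ _
  simp only [ContinuousAlternatingMap.add_apply, curryLeft_apply_apply,
    alternatizeUncurryFin_apply, hA]
  rw [Fin.sum_univ_succ, add_assoc, ← Finset.sum_add_distrib, Finset.sum_eq_zero, add_zero]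
  · simp
  · intro i _
    simp [hcons, pow_succ]

theorem dForm_eq_alternatizeUncurryFin {k : ℕ} (Ω : Opens E) (φ : TestForm Ω k) :
    ⇑(dForm Ω k φ) = fun x ↦ alternatizeUncurryFinCLM ℝ E ℂ (fderiv ℝ φ x) :=
  funext fun x ↦ dForm_apply Ω k φ x

/-- The average of `dφ` is obtained from the average of the full derivative of `φ`, taken with the
same weight, by antisymmetrization. -/
theorem lineAverage_dForm {k : ℕ} {Ω : Opens E} {μ : Measure ℝ} [IsFiniteMeasure μ] {w c : ℝ → ℝ}
    {e : E} (hw : Continuous w) (hc : Continuous c) (hw1 : ∀ᵐ t ∂μ, ‖w t‖ ≤ 1)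
    (φ : TestForm Ω k) (x : E) :
    lineAverage μ w c e (dForm Ω k φ) x =
      alternatizeUncurryFin (lineAverage μ w c e (fderiv ℝ φ) x) := by
  rw [dForm_eq_alternatizeUncurryFin]
  exact lineAverage_comp_clm (alternatizeUncurryFinCLM ℝ E ℂ) hw hc hw1
    (φ.contDiff.continuous_fderiv (by simp)) (φ.hasCompactSupport.fderiv ℝ) x

/-- The homotopy of the cone with vertex `0` on the segment from `0` to `x`: it is the fundamental
theorem of calculus for `t ↦ t ^ (q + 1) ψ(t x)`. -/
theorem lineAverage_cone_fderiv_apply {F : Type u} [NormedAddCommGroup F] [NormedSpace ℝ F]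
    [CompleteSpace F] {q : ℕ} {ψ : E → F} (hψ : ContDiff ℝ ∞ ψ) (hs : HasCompactSupport ψ) (x : E) :
    lineAverage (volume.restrict (Icc 0 1)) (fun t ↦ t ^ (q + 1)) id (0 : E) (fderiv ℝ ψ) x x +
      ((q : ℝ) + 1) • lineAverage (volume.restrict (Icc 0 1)) (fun t ↦ t ^ q) id (0 : E) ψ x =
        ψ x := by
  have hb (n : ℕ) : ∀ᵐ t ∂(volume.restrict (Icc (0 : ℝ) 1)), ‖t ^ n‖ ≤ 1 := by
    filter_upwards [ae_restrict_mem measurableSet_Icc] with t ht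
    rw [norm_pow, Real.norm_of_nonneg ht.1]
    exact pow_le_one₀ ht.1 ht.2
  have hD : Continuous (fderiv ℝ ψ) := hψ.continuous_fderiv (by simp)
  have hψc := hψ.continuous
  have h1 := lineAverage_comp_clm (e := (0 : E)) (ContinuousLinearMap.apply ℝ F x) (by fun_prop)
    continuous_id (hb (q + 1)) hD (hs.fderiv ℝ) x
  simp only [ContinuousLinearMap.apply_apply] at h1
  rw [← h1, lineAverage, ← integral_smul, ← integral_add, integral_Icc_eq_integral_Ioc,
    ← intervalIntegral.integral_of_le zero_le_one,
    intervalIntegral.integral_eq_sub_of_hasDerivAt (f := fun t : ℝ ↦ t ^ (q + 1) • ψ (t • x))]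
  · simp
  · intro t _
    have h2 : HasDerivAt (fun t : ℝ ↦ ψ (t • x)) (fderiv ℝ ψ (t • x) x) t := by
      have := ((hψ.differentiable (by simp)) (t • x)).hasFDerivAt.comp_hasDerivAt t
        ((hasDerivAt_id t).smul_const x)
      simpa [Function.comp_def] using this
    have h3 := (hasDerivAt_pow (q + 1) t).smul h2
    refine h3.congr_deriv ?_
    simp [smul_smul]
  · exact Continuous.intervalIntegrable (by fun_prop) _ _
  · exact (Continuous.integrableOn_Icc (by fun_prop))
  · exact (Continuous.integrableOn_Icc (by fun_prop))

theorem hasFDerivAt_bilin_id {F F' : Type*} [NormedAddCommGroup F] [NormedSpace ℝ F]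
    [NormedAddCommGroup F'] [NormedSpace ℝ F'] (B : F →L[ℝ] E →L[ℝ] F') {α : E → F} {D : E →L[ℝ] F}
    {x : E} (hα : HasFDerivAt α D x) :
    HasFDerivAt (fun y ↦ B (α y) y) (B (α x) + (B ∘L D).flip x) x := by
  have hB : HasFDerivAt (fun y ↦ B (α y)) (B ∘L D) x := B.hasFDerivAt.comp x hα
  exact hB.clm_apply (hasFDerivAt_id x)

/-- The cone operator with vertex `0`, cut off outside the ball of radius `3`. It does not enlarge
supports in the complement of a ball around `0`, and it is a chain homotopy from the identity to
zero on the ball of radius `2`. -/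
theorem exists_cone_clm [FiniteDimensional ℝ E] :
    ∃ C : ∀ q : ℕ, TestForm (⊤ : Opens E) (q + 1) →L[ℂ] TestForm (⊤ : Opens E) q,
      (∀ q φ r, (∀ x ∈ Metric.ball 0 r, φ x = 0) → ∀ x ∈ Metric.ball 0 r, C q φ x = 0) ∧
      ∀ q ψ, ∀ x ∈ Metric.ball (0 : E) 2,
        dForm ⊤ q (C q ψ) x + C (q + 1) (dForm ⊤ (q + 1) ψ) x = ψ x := by
  have : ProperSpace E := FiniteDimensional.proper ℝ E
  let χ : ContDiffBump (0 : E) := ⟨2, 3, by norm_num, by norm_num⟩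
  have hb (n : ℕ) : ∀ᵐ t ∂(volume.restrict (Icc (0 : ℝ) 1)), ‖t ^ n‖ ≤ 1 := by
    filter_upwards [ae_restrict_mem measurableSet_Icc] with t ht
    rw [norm_pow, Real.norm_of_nonneg ht.1]
    exact pow_le_one₀ ht.1 ht.2
  have hb1 : ∀ᵐ t ∂(volume.restrict (Icc (0 : ℝ) 1)), ‖id t‖ ≤ 1 := by simpa using hb 1
  let J (q : ℕ) (φ : E → E [⋀^Fin (q + 1)]→L[ℝ] ℂ) : E → E [⋀^Fin (q + 1)]→L[ℝ] ℂ :=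
    lineAverage (volume.restrict (Icc 0 1)) (fun t ↦ t ^ q) id (0 : E) φ
  have hex (q : ℕ) := exists_testFunction_clm
    (fun φ : E → E [⋀^Fin (q + 1)]→L[ℝ] ℂ ↦ fun x ↦ (J q φ x).curryLeft (χ x • x))
    (fun K ↦ ⟨⟨Metric.closedBall 0 3, isCompact_closedBall _ _⟩,
      exists_contract_lineAverage_clm (by fun_prop) continuous_id (hb q) hb1
        (χ.contDiff.smul contDiff_id) (fun x hx ↦ by
          have : χ x = 0 := χ.zero_of_le_dist (by
            simpa using (not_le.1 fun h ↦ hx (Metric.mem_closedBall.2 h)).le)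
          simp [this])⟩)
  choose C hC using hex
  refine ⟨C, fun q φ r hφ x hx ↦ ?_, fun q ψ x hx ↦ ?_⟩
  · have : J q φ x = 0 := by
      refine (setIntegral_congr_fun measurableSet_Icc fun t ht ↦ ?_).trans (integral_zero _ _)
      have : φ (id t • x + t • 0) = 0 := hφ _ (by
        rw [mem_ball_zero_iff] at hx ⊢
        rw [smul_zero, add_zero, norm_smul, id, Real.norm_of_nonneg ht.1]
        exact (mul_le_of_le_one_left (norm_nonneg _) ht.2).trans_lt hx)
      exact (congrArg _ this).trans (smul_zero _)
    rw [hC]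
    simp [this]
  · have hnear : ⇑(C q ψ) =ᶠ[nhds x] fun y ↦ (J q ψ y).curryLeft y := by
      filter_upwards [Metric.isOpen_ball.mem_nhds hx] with y hy
      simp only [hC]
      rw [χ.one_of_mem_closedBall (Metric.ball_subset_closedBall hy), one_smul]
    let D : E →L[ℝ] E [⋀^Fin (q + 1)]→L[ℝ] ℂ :=
      lineAverage (volume.restrict (Icc 0 1)) (fun t ↦ t ^ (q + 1)) id (0 : E) (fderiv ℝ ψ) x
    have hJ : HasFDerivAt (J q ψ) D x := hasFDerivAt_lineAverage (by fun_prop) continuous_id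
      (hb q) hb1 (ψ.contDiff.of_le (by simp)) ψ.hasCompactSupport x
    let B : (E [⋀^Fin (q + 1)]→L[ℝ] ℂ) →L[ℝ] E →L[ℝ] E [⋀^Fin q]→L[ℝ] ℂ :=
      (curryLeftLI (𝕜 := ℝ) (E := E) (F := ℂ) (n := q)).toContinuousLinearMap
    have hd := hasFDerivAt_bilin_id B hJ
    have h1 : dForm ⊤ q (C q ψ) x =
        alternatizeUncurryFin (B (J q ψ x)) + alternatizeUncurryFin ((B ∘L D).flip x) := by
      rw [dForm_apply, hnear.extDeriv_eq, extDeriv, ← alternatizeUncurryFin_add]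
      exact congrArg alternatizeUncurryFin hd.fderiv
    have h2 : C (q + 1) (dForm ⊤ (q + 1) ψ) x = (alternatizeUncurryFin D).curryLeft x := by
      simp only [hC]
      rw [χ.one_of_mem_closedBall (Metric.ball_subset_closedBall hx), one_smul,
        ← lineAverage_dForm (by fun_prop) continuous_id (hb _)]
    have h3 := curryLeft_alternatizeUncurryFin_add D ((B ∘L D).flip x) x fun h ↦ rfl
    -- Differentiating the Euler field `y ↦ y` itself contributes the degree of the form.
    have h4 : alternatizeUncurryFin (B (J q ψ x)) = ((q : ℝ) + 1) • J q ψ x := by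
      refine (alternatizeUncurryFin_curryLeft (J q ψ x)).trans ?_
      rw [← Nat.cast_smul_eq_nsmul ℝ]
      simp
    rw [h1, h2, h4, ← lineAverage_cone_fderiv_apply (q := q) ψ.contDiff ψ.hasCompactSupport x]
    change _ = D x + _
    rw [← h3]
    abel

end Cone

/-! ### Integration along parallel lines -/

section Fiber
universe u
variable {E F : Type u} [NormedAddCommGroup E] [NormedSpace ℝ E]
  [NormedAddCommGroup F] [NormedSpace ℝ F]

/-- The integral of `φ` over the points `x + t e` with `t ∈ s`. -/
abbrev fiberIntegral (s : Set ℝ) (e : E) (φ : E → F) (x : E) : F :=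
  lineAverage (volume.restrict s) (fun _ ↦ 1) (fun _ ↦ 1) e φ x

/-- The integral of `φ` along the half-line arriving at `x` in the direction `e`, corrected by a
multiple of the integral along the whole line so as to have compact support again. Here `ℓ` is a
linear form with `ℓ e = 1`, and the smooth step function applied to `ℓ x` is the correcting
factor. -/
def fiberPrimitive (e : E) (ℓ : E →L[ℝ] ℝ) (φ : E → F) (x : E) : F :=
  fiberIntegral (Iic 0) e φ x - Real.smoothTransition (ℓ x) • fiberIntegral univ e φ x

theorem fiberIntegral_congr {s s' : Set ℝ} (hs : MeasurableSet s') (h : s ⊆ s')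
    {e : E} {φ : E → F} {x : E} (h0 : ∀ t ∈ s' \ s, φ (x + t • e) = 0) :
    fiberIntegral s' e φ x = fiberIntegral s e φ x := by
  refine setIntegral_eq_of_subset_of_forall_sdiff_eq_zero hs h fun t ht ↦ ?_
  simp [h0 t ht]

theorem fiberIntegral_eq_zero {s : Set ℝ} (hs : MeasurableSet s)
    {e : E} {φ : E → F} {x : E} (h0 : ∀ t ∈ s, φ (x + t • e) = 0) :
    fiberIntegral s e φ x = 0 := by
  rw [fiberIntegral_congr hs (empty_subset s) (by simpa using h0)]
  simp [lineAverage]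

/-- Near `x`, only a bounded piece of the line contributes to the integrals over lines of a
compactly supported function. -/
theorem fiberPrimitive_eq_of_norm_le {e : E} (he : e ≠ 0) {ℓ : E →L[ℝ] ℝ} {φ : E → F} {R r M : ℝ}
    (hR : ∀ y, R < ‖y‖ → φ y = 0) (hM : (R + r) / ‖e‖ < M) {x : E} (hx : ‖x‖ ≤ r) :
    fiberPrimitive e ℓ φ x = fiberIntegral (Icc (-M) 0) e φ x -
        Real.smoothTransition (ℓ x) • fiberIntegral (Icc (-M) M) e φ x := by
  have h0 (t : ℝ) (ht : M < |t|) : φ (x + t • e) = 0 := by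
    refine hR _ ?_
    have h1 : ‖t • e‖ ≤ ‖x + t • e‖ + ‖x‖ := by
      simpa using norm_sub_le (x + t • e) x
    rw [norm_smul, Real.norm_eq_abs] at h1
    have h2 := (div_lt_iff₀ (norm_pos_iff.2 he)).1 (hM.trans ht)
    linarith
  rw [fiberPrimitive, fiberIntegral_congr measurableSet_Iic Icc_subset_Iic_self,
    fiberIntegral_congr .univ (subset_univ (Icc (-M) M))]
  · rintro t ⟨-, ht⟩
    refine h0 t (not_le.1 fun h ↦ ht (abs_le.1 h))
  · rintro t ⟨ht0, ht⟩
    refine h0 t (not_le.1 fun h ↦ ht ⟨(abs_le.1 h).1, ht0⟩)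

/-- Where `ℓ x` is large the two integrals in the fibre primitive agree and cancel; where `-ℓ x` is
large the integral over the half-line and the correcting factor both vanish. -/
theorem fiberPrimitive_eq_zero {e : E} {ℓ : E →L[ℝ] ℝ} (hℓ : ℓ e = 1) {φ : E → F} {R : ℝ}
    (hR0 : 0 ≤ R) (hR : ∀ y, R < ‖y‖ → φ y = 0) {x : E}
    (hx : R + (2 * (‖ℓ‖ * R) + 1) * ‖e‖ < ‖x‖) : fiberPrimitive e ℓ φ x = 0 := by
  have hb (t : ℝ) (ht : φ (x + t • e) ≠ 0) : |ℓ x + t| ≤ ‖ℓ‖ * R := by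
    have h1 : ‖x + t • e‖ ≤ R := not_lt.1 fun h ↦ ht (hR _ h)
    have h2 := (ℓ.le_opNorm (x + t • e)).trans (mul_le_mul_of_nonneg_left h1 (norm_nonneg _))
    simpa [hℓ] using h2
  have hp : 0 ≤ ‖ℓ‖ * R := by positivity
  rcases le_total (‖ℓ‖ * R + 1) (ℓ x) with h | h
  · rw [fiberPrimitive, Real.smoothTransition.one_of_one_le (by linarith), one_smul,
      fiberIntegral_congr .univ (subset_univ (Iic 0)), sub_self]
    rintro t ⟨-, ht⟩
    by_contra h0
    have := (abs_le.1 (hb t h0)).2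
    exact ht (by simp only [mem_Iic]; linarith)
  rcases le_total (ℓ x) (-(‖ℓ‖ * R + 1)) with h' | h'
  · rw [fiberPrimitive, Real.smoothTransition.zero_of_nonpos (by linarith), zero_smul, sub_zero,
      fiberIntegral_eq_zero measurableSet_Iic]
    intro t ht
    by_contra h0
    have := (abs_le.1 (hb t h0)).1
    linarith [mem_Iic.1 ht]
  · have h0 (t : ℝ) : φ (x + t • e) = 0 := by
      by_contra h0
      have h1 : ‖x + t • e‖ ≤ R := not_lt.1 fun h ↦ h0 (hR _ h)
      have h2 := abs_le.1 (hb t h0)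
      have h3 : |t| ≤ 2 * (‖ℓ‖ * R) + 1 := abs_le.2 ⟨by linarith, by linarith⟩
      have h4 : ‖x‖ ≤ ‖x + t • e‖ + ‖t • e‖ := by simpa using norm_sub_le (x + t • e) (t • e)
      rw [norm_smul, Real.norm_eq_abs] at h4
      have := mul_le_mul_of_nonneg_right h3 (norm_nonneg e)
      linarith
    rw [fiberPrimitive, fiberIntegral_eq_zero measurableSet_Iic fun t _ ↦ h0 t,
      fiberIntegral_eq_zero .univ fun t _ ↦ h0 t]
    simp

/-- The fundamental theorem of calculus along a segment in the direction `e`. -/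
theorem fiberIntegral_fderiv_apply [CompleteSpace F] {φ : E → F} (hφ : ContDiff ℝ ∞ φ)
    (hs : HasCompactSupport φ) {a b : ℝ} (hab : a ≤ b) (e x : E) :
    fiberIntegral (Icc a b) e (fderiv ℝ φ) x e = φ (x + b • e) - φ (x + a • e) := by
  have hD : Continuous (fderiv ℝ φ) := hφ.continuous_fderiv (by simp)
  have h1 := lineAverage_comp_clm (μ := volume.restrict (Icc a b)) (w := fun _ ↦ 1) (c := fun _ ↦ 1)
    (e := e) (ContinuousLinearMap.apply ℝ F e) (by fun_prop) (by fun_prop) (by simp) hD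
    (hs.fderiv ℝ) x
  simp only [ContinuousLinearMap.apply_apply, one_smul] at h1
  rw [fiberIntegral, ← h1, integral_Icc_eq_integral_Ioc, ← intervalIntegral.integral_of_le hab,
    intervalIntegral.integral_eq_sub_of_hasDerivAt (f := fun t : ℝ ↦ φ (x + t • e))]
  · intro t _
    have := ((hφ.differentiable (by simp)) (x + t • e)).hasFDerivAt.comp_hasDerivAt t
      (((hasDerivAt_id t).smul_const e).const_add x)
    simpa [Function.comp_def] using this
  · exact Continuous.intervalIntegrable (by fun_prop) _ _

/-- Contracting the fibre primitive with `e` is a continuous operator on test forms. -/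
theorem exists_fiber_clm [FiniteDimensional ℝ E] {e : E} {ℓ : E →L[ℝ] ℝ} (hℓ : ℓ e = 1) (q : ℕ) :
    ∃ P : TestForm (⊤ : Opens E) (q + 1) →L[ℂ] TestForm (⊤ : Opens E) q,
      ∀ φ : TestForm (⊤ : Opens E) (q + 1),
        ⇑(P φ) = fun x ↦ (fiberPrimitive e ℓ φ x).curryLeft e := by
  have : ProperSpace E := FiniteDimensional.proper ℝ E
  have he : e ≠ 0 := by rintro rfl; simp at hℓ
  refine exists_testFunction_clm
    (fun (φ : E → E [⋀^Fin (q + 1)]→L[ℝ] ℂ) x ↦ (fiberPrimitive e ℓ φ x).curryLeft e) fun K ↦ ?_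
  obtain ⟨R, hR0, hKR⟩ := K.isCompact.isBounded.subset_closedBall_lt 0 0
  set R' := R + (2 * (‖ℓ‖ * R) + 1) * ‖e‖ with hR'
  have hR'0 : 0 < R' := by positivity
  obtain ⟨M, hM⟩ := exists_gt ((R + (R' + 2)) / ‖e‖)
  -- The fibre primitive is supported in the ball of radius `R'`, where the cutoff `η` is `1`.
  let η : ContDiffBump (0 : E) := ⟨R' + 1, R' + 2, by positivity, by linarith⟩
  have hη : ∀ x, R' + 2 ≤ ‖x‖ → η x = 0 := fun x hx ↦ η.zero_of_le_dist (by simpa using hx)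
  have hηK (x : E) (hx : x ∈ (Metric.closedBall (0 : E) (R' + 2))ᶜ) : η x = 0 :=
    hη x (by simpa using (not_le.1 fun h ↦ hx (mem_closedBall_zero_iff.2 h)).le)
  obtain ⟨T₁, hT₁⟩ := exists_contract_lineAverage_clm (μ := volume.restrict (Icc (-M) 0))
    (w := fun _ ↦ 1) (c := fun _ ↦ 1) (e := e) (q := q) (K := K)
    (K' := ⟨Metric.closedBall 0 (R' + 2), isCompact_closedBall _ _⟩) (g := fun x ↦ η x • e)
    (by fun_prop) (by fun_prop) (by simp) (by simp) (η.contDiff.smul contDiff_const)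
    fun x hx ↦ by simp [hηK x hx]
  obtain ⟨T₂, hT₂⟩ := exists_contract_lineAverage_clm (μ := volume.restrict (Icc (-M) M))
    (w := fun _ ↦ 1) (c := fun _ ↦ 1) (e := e) (q := q) (K := K)
    (K' := ⟨Metric.closedBall 0 (R' + 2), isCompact_closedBall _ _⟩)
    (g := fun x ↦ (η x * Real.smoothTransition (ℓ x)) • e)
    (by fun_prop) (by fun_prop) (by simp) (by simp)
    ((η.contDiff.mul (Real.smoothTransition.contDiff.comp ℓ.contDiff)).smul contDiff_const)
    fun x hx ↦ by simp [hηK x hx]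
  refine ⟨_, T₁ - T₂, fun φ ↦ funext fun x ↦ ?_⟩
  have hφ : ∀ y, R < ‖y‖ → φ y = 0 := fun y hy ↦
    φ.zero_on_compl fun h ↦ hy.not_ge (mem_closedBall_zero_iff.1 (hKR h))
  have hT : (T₁ - T₂) φ x = η x • (fiberIntegral (Icc (-M) 0) e φ x -
        Real.smoothTransition (ℓ x) • fiberIntegral (Icc (-M) M) e φ x).curryLeft e := by
    have : (T₁ - T₂) φ x = T₁ φ x - T₂ φ x := rfl
    rw [this, hT₁, hT₂]
    ext v
    simp [mul_assoc, sub_eq_add_neg]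
  rw [hT]
  rcases le_total ‖x‖ (R' + 1) with h | h
  · rw [η.one_of_mem_closedBall (mem_closedBall_zero_iff.2 h), one_smul,
      ← fiberPrimitive_eq_of_norm_le he hφ hM (h.trans (by linarith))]
  · rw [fiberPrimitive_eq_zero hℓ hR0.le hφ (by linarith)]
    rcases le_total ‖x‖ (R' + 2) with h' | h'
    · rw [← fiberPrimitive_eq_of_norm_le he hφ hM h',
        fiberPrimitive_eq_zero hℓ hR0.le hφ (by linarith)]
      simp
    · simp [hη x h']

end Fiber

section FiberHomotopy
universe u
variable {E : Type u} [NormedAddCommGroup E] [NormedSpace ℝ E]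

theorem hasFDerivAt_bilin_const {F F' : Type*} [NormedAddCommGroup F] [NormedSpace ℝ F]
    [NormedAddCommGroup F'] [NormedSpace ℝ F'] (B : F →L[ℝ] E →L[ℝ] F') {α : E → F} {D : E →L[ℝ] F}
    {x : E} (v : E) (hα : HasFDerivAt α D x) :
    HasFDerivAt (fun y ↦ B (α y) v) ((B ∘L D).flip v) x := by
  have hB : HasFDerivAt (fun y ↦ B (α y)) (B ∘L D) x := B.hasFDerivAt.comp x hα
  refine (hB.clm_apply (hasFDerivAt_const v x)).congr_fderiv ?_
  ext
  simp

/-- The derivative of the fibre primitive: besides the fibre primitive of the derivative there is a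
term coming from the correcting factor. The integrals at `x` are expressed by a segment of length
`2 M` at whose end points `φ` vanishes, and which serves all functions with support
in that of `φ`. -/
theorem exists_hasFDerivAt_fiberPrimitive {F : Type u} [NormedAddCommGroup F] [NormedSpace ℝ F]
    [CompleteSpace F] {e : E} (he : e ≠ 0) (ℓ : E →L[ℝ] ℝ) {φ : E → F} (hφ : ContDiff ℝ ∞ φ)
    (hs : HasCompactSupport φ) (x : E) :
    ∃ M : ℝ, 0 ≤ M ∧ φ (x + M • e) = 0 ∧ φ (x + (-M) • e) = 0 ∧
      (∀ {G : Type u} [NormedAddCommGroup G] [NormedSpace ℝ G] (ψ : E → G),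
        tsupport ψ ⊆ tsupport φ → fiberPrimitive e ℓ ψ x = fiberIntegral (Icc (-M) 0) e ψ x -
          Real.smoothTransition (ℓ x) • fiberIntegral (Icc (-M) M) e ψ x) ∧
      HasFDerivAt (fiberPrimitive e ℓ φ) (fiberIntegral (Icc (-M) 0) e (fderiv ℝ φ) x -
        (Real.smoothTransition (ℓ x) • fiberIntegral (Icc (-M) M) e (fderiv ℝ φ) x +
          (deriv Real.smoothTransition (ℓ x) • ℓ).smulRight
            (fiberIntegral (Icc (-M) M) e φ x))) x := by
  obtain ⟨R, hR0, hR⟩ := hs.isCompact.isBounded.subset_closedBall_lt 0 0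
  have hR' {G : Type u} [NormedAddCommGroup G] [NormedSpace ℝ G] (ψ : E → G)
      (hψ : tsupport ψ ⊆ tsupport φ) (y : E) (hy : R < ‖y‖) : ψ y = 0 :=
    image_eq_zero_of_notMem_tsupport fun h ↦
      hy.not_ge (mem_closedBall_zero_iff.1 (hR (hψ h)))
  obtain ⟨M, hM⟩ := exists_gt ((R + (‖x‖ + 1)) / ‖e‖)
  have hM0 : 0 ≤ M := le_trans (by positivity) hM.le
  have hMe : R + (‖x‖ + 1) < M * ‖e‖ := (div_lt_iff₀ (norm_pos_iff.2 he)).1 hM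
  refine ⟨M, hM0, hR' φ subset_rfl _ ?_, hR' φ subset_rfl _ ?_, fun ψ hψ ↦
    fiberPrimitive_eq_of_norm_le he (hR' ψ hψ) hM (by linarith), ?_⟩
  · have : ‖M • e‖ ≤ ‖x + M • e‖ + ‖x‖ := by simpa using norm_sub_le (x + M • e) x
    rw [norm_smul, Real.norm_of_nonneg hM0] at this
    linarith
  · have : ‖(-M) • e‖ ≤ ‖x + (-M) • e‖ + ‖x‖ := by simpa using norm_sub_le (x + (-M) • e) x
    rw [norm_smul, norm_neg, Real.norm_of_nonneg hM0] at this
    linarith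
  · have hI (a b : ℝ) : HasFDerivAt (fun y ↦ fiberIntegral (Icc a b) e φ y)
        (fiberIntegral (Icc a b) e (fderiv ℝ φ) x) x := by
      have := hasFDerivAt_lineAverage (μ := volume.restrict (Icc a b)) (w := fun _ ↦ 1)
        (c := fun _ ↦ 1) (e := e) (by fun_prop) (by fun_prop) (by simp) (by simp)
        (hφ.of_le (by simp)) hs x
      simpa only [one_mul] using this
    have hθ : HasFDerivAt (fun y ↦ Real.smoothTransition (ℓ y))
        (deriv Real.smoothTransition (ℓ x) • ℓ) x :=
      ((Real.smoothTransition.contDiff (n := 1)).differentiable one_ne_zero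
        (ℓ x)).hasDerivAt.comp_hasFDerivAt x ℓ.hasFDerivAt
    refine ((hI (-M) 0).sub (hθ.smul (hI (-M) M))).congr_of_eventuallyEq ?_
    filter_upwards [Metric.ball_mem_nhds x one_pos] with y hy
    refine fiberPrimitive_eq_of_norm_le he (hR' φ subset_rfl) hM ?_
    have := norm_sub_norm_le y x
    rw [← dist_eq_norm] at this
    linarith [Metric.mem_ball.1 hy]

/-- The contracted fibre primitive is a chain homotopy between the identity and an operator whose
values are multiples of `ℓ ∧ ι_e β`, where `β` is the integral of the form over a line. The wedge
product `ℓ ∧ α` is written as the antisymmetrization of `h ↦ ℓ h • α`. -/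
theorem dForm_fiber_add {e : E} {ℓ : E →L[ℝ] ℝ} (hℓ : ℓ e = 1) {q : ℕ}
    (φ : TestForm (⊤ : Opens E) (q + 1)) (Pφ : TestForm (⊤ : Opens E) q)
    (Pdφ : TestForm (⊤ : Opens E) (q + 1))
    (hP : ⇑Pφ = fun x ↦ (fiberPrimitive e ℓ φ x).curryLeft e)
    (hPd : ⇑Pdφ = fun x ↦ (fiberPrimitive e ℓ (dForm ⊤ (q + 1) φ) x).curryLeft e) (x : E) :
    ∃ (a : ℝ) (β : E [⋀^Fin (q + 1)]→L[ℝ] ℂ), (∀ v, (∀ y, φ y v = 0) → β v = 0) ∧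
      dForm ⊤ q Pφ x + Pdφ x =
        φ x - alternatizeUncurryFin ((a • ℓ).smulRight (β.curryLeft e)) := by
  have he : e ≠ 0 := by rintro rfl; simp at hℓ
  obtain ⟨M, hM, h1, h2, h3, h4⟩ :=
    exists_hasFDerivAt_fiberPrimitive he ℓ φ.contDiff φ.hasCompactSupport x
  set D₁ := fiberIntegral (Icc (-M) 0) e (fderiv ℝ φ) x with hD₁
  set D₂ := fiberIntegral (Icc (-M) M) e (fderiv ℝ φ) x with hD₂
  set β := fiberIntegral (Icc (-M) M) e φ x with hβ
  set a := deriv Real.smoothTransition (ℓ x)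
  set θ := Real.smoothTransition (ℓ x)
  refine ⟨a, β, fun v hv ↦ ?_, ?_⟩
  · have := lineAverage_comp_clm (μ := volume.restrict (Icc (-M) M)) (w := fun _ ↦ 1)
      (c := fun _ ↦ 1) (e := e) (apply ℝ E ℂ v) (by fun_prop) (by fun_prop) (by simp)
      φ.continuous φ.hasCompactSupport x
    refine Eq.trans this.symm ?_
    simp [hv]
  · let B : (E [⋀^Fin (q + 1)]→L[ℝ] ℂ) →L[ℝ] E →L[ℝ] E [⋀^Fin q]→L[ℝ] ℂ :=
      (curryLeftLI (𝕜 := ℝ) (E := E) (F := ℂ) (n := q)).toContinuousLinearMap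
    set S : E →L[ℝ] E [⋀^Fin (q + 1)]→L[ℝ] ℂ := (a • ℓ).smulRight β
    set D := D₁ - (θ • D₂ + S) with hD
    have e1 : dForm ⊤ q Pφ x = alternatizeUncurryFin ((B ∘L D).flip e) := by
      rw [dForm_apply, hP]
      exact congrArg alternatizeUncurryFin (hasFDerivAt_bilin_const B e h4).fderiv
    have e2 : Pdφ x = (alternatizeUncurryFin (D₁ - θ • D₂)).curryLeft e := by
      have hI (a b : ℝ) : fiberIntegral (Icc a b) e (dForm ⊤ (q + 1) φ) x =
          alternatizeUncurryFinCLM ℝ E ℂ (fiberIntegral (Icc a b) e (fderiv ℝ φ) x) :=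
        lineAverage_dForm (by fun_prop) (by fun_prop) (by simp) φ x
      rw [hPd]
      dsimp only
      rw [h3, hI, hI, ← map_smul, ← map_sub]
      · rfl
      · rw [dForm_eq_alternatizeUncurryFin]
        exact (tsupport_comp_subset (_root_.map_zero _) _).trans (tsupport_fderiv_subset ℝ)
    have e3 : D₁ - θ • D₂ = D + S := by rw [hD]; abel
    have e4 : D e + S e = φ x := by
      have : D e + S e = D₁ e - θ • D₂ e := by
        rw [← _root_.add_apply, ← e3]
        rfl
      rw [this, hD₁, hD₂, fiberIntegral_fderiv_apply φ.contDiff φ.hasCompactSupport (by linarith),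
        fiberIntegral_fderiv_apply φ.contDiff φ.hasCompactSupport (by linarith), h1, h2]
      simp
    -- Cartan's formula for the derivative `D` of the fibre primitive, and for its part `S` coming
    -- from the correcting factor, which contributes the error term.
    have c1 := curryLeft_alternatizeUncurryFin_add D ((B ∘L D).flip e) e fun h ↦ rfl
    have c2 := curryLeft_alternatizeUncurryFin_add S ((a • ℓ).smulRight (β.curryLeft e)) e
      fun h ↦ rfl
    rw [e1, e2, e3, alternatizeUncurryFin_add, curryLeft_add, _root_.add_apply, ← e4,
      ← c1, ← c2]
    abel

end FiberHomotopy

/-! ### The Poincaré lemma with compact supports -/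

section Homotopy
universe u
variable {E : Type u} [NormedAddCommGroup E] [NormedSpace ℝ E]

/-- The form `ℓ ∧ ι_{b m} β`, with `ℓ` the coordinate number `m`, keeps from the components of `β`
only those that involve `m`. -/
theorem alternatizeUncurryFin_smulRight_basis_eq_zero {ι : Type*} (b : ι → E) {m : ι}
    {ℓ : E →L[ℝ] ℝ} (hℓ : ∀ j, j ≠ m → ℓ (b j) = 0) {q : ℕ} (β : E [⋀^Fin (q + 1)]→L[ℝ] ℂ)
    (J : Fin (q + 1) → ι) (hJ : m ∉ range J ∨ β (b ∘ J) = 0) (a : ℝ) :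
    alternatizeUncurryFin ((a • ℓ).smulRight (β.curryLeft (b m))) (b ∘ J) = 0 := by
  rw [alternatizeUncurryFin_apply]
  refine Finset.sum_eq_zero fun i _ ↦ ?_
  by_cases hi : J i = m
  · have h0 : β (b ∘ J) = 0 := hJ.resolve_left fun h ↦ h ⟨i, hi⟩
    have h1 := neg_one_pow_smul_map_insertNth β i ((b ∘ J) i) (i.removeNth (b ∘ J))
    rw [Fin.insertNth_self_removeNth, h0, smul_zero] at h1
    have h2 : (b ∘ J) i = b m := by simp [hi]
    rw [h2] at h1
    simp [← h1]
  · simp [hℓ _ hi]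

/-- One step of the compactly supported Poincaré lemma: there is a homotopy operator which is exact
on all components that do not involve the basis vector number `m`, and which preserves the
vanishing of components. -/
theorem exists_fiber_homotopy [FiniteDimensional ℝ E] {ι : Type*} (b : Module.Basis ι ℝ E) (m : ι) :
    ∃ P : ∀ q : ℕ, TestForm (⊤ : Opens E) (q + 1) →L[ℂ] TestForm (⊤ : Opens E) q,
      ∀ q φ (J : Fin (q + 1) → ι), (m ∉ range J ∨ ∀ y, φ y (b ∘ J) = 0) → ∀ x,
        (dForm ⊤ q (P q φ) x + P (q + 1) (dForm ⊤ (q + 1) φ) x) (b ∘ J) = φ x (b ∘ J) := by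
  classical
  let ℓ : E →L[ℝ] ℝ := (b.coord m).toContinuousLinearMap
  have hℓ : ℓ (b m) = 1 := by simp [ℓ]
  choose P hP using exists_fiber_clm hℓ
  refine ⟨P, fun q φ J hJ x ↦ ?_⟩
  obtain ⟨a, β, hβ, h⟩ := dForm_fiber_add hℓ φ (P q φ) (P (q + 1) (dForm ⊤ (q + 1) φ)) (hP q φ)
    (hP _ _) x
  rw [h, ContinuousAlternatingMap.sub_apply,
    alternatizeUncurryFin_smulRight_basis_eq_zero b (fun j hj ↦ ?_) β J (hJ.imp_right (hβ _)),
    sub_zero]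
  simp [ℓ, hj]

/-- Composing the one-step homotopies for the basis vectors in `s` gives a homotopy operator that is
exact on every component that misses some element of `s`. -/
theorem exists_homotopy_finset [FiniteDimensional ℝ E] {ι : Type*} (b : Module.Basis ι ℝ E)
    (s : Finset ι) :
    ∃ H : ∀ q : ℕ, TestForm (⊤ : Opens E) (q + 1) →L[ℂ] TestForm (⊤ : Opens E) q,
      ∀ q φ (J : Fin (q + 1) → ι), (∃ m ∈ s, m ∉ range J) → ∀ x,
        (dForm ⊤ q (H q φ) x + H (q + 1) (dForm ⊤ (q + 1) φ) x) (b ∘ J) = φ x (b ∘ J) := by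
  classical
  induction s using Finset.induction_on with
  | empty => exact ⟨fun _ ↦ 0, by simp⟩
  | insert m s _ ih =>
    obtain ⟨H, hH⟩ := ih
    obtain ⟨P, hP⟩ := exists_fiber_homotopy b m
    -- The operator `R` is what the homotopy `H` leaves over. It commutes with `d`, so that `P ∘ R`
    -- can be added to `H`.
    let R (q : ℕ) : TestForm (⊤ : Opens E) (q + 1) →L[ℂ] TestForm (⊤ : Opens E) (q + 1) :=
      .id ℂ _ - dForm ⊤ q ∘L H q - H (q + 1) ∘L dForm ⊤ (q + 1)
    have hR (q : ℕ) (φ : TestForm (⊤ : Opens E) (q + 1)) :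
        R q φ = φ - dForm ⊤ q (H q φ) - H (q + 1) (dForm ⊤ (q + 1) φ) := rfl
    have hRd (q : ℕ) (φ : TestForm (⊤ : Opens E) (q + 1)) :
        R (q + 1) (dForm ⊤ (q + 1) φ) = dForm ⊤ (q + 1) (R q φ) := by
      simp only [hR, map_sub, dForm_dForm, _root_.map_zero, sub_zero]
    refine ⟨fun q ↦ H q + P q ∘L R q, fun q φ J hJ x ↦ ?_⟩
    have hsum : dForm ⊤ q ((H q + P q ∘L R q) φ) x +
        (H (q + 1) + P (q + 1) ∘L R (q + 1)) (dForm ⊤ (q + 1) φ) x =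
        (dForm ⊤ q (H q φ) x + H (q + 1) (dForm ⊤ (q + 1) φ) x) +
          (dForm ⊤ q (P q (R q φ)) x + P (q + 1) (dForm ⊤ (q + 1) (R q φ)) x) := by
      rw [← hRd]
      simp only [_root_.add_apply, ContinuousLinearMap.comp_apply, map_add]
      abel
    have hRx (y : E) : R q φ y =
        φ y - (dForm ⊤ q (H q φ) y + H (q + 1) (dForm ⊤ (q + 1) φ) y) := by
      rw [hR, ← sub_sub]
      rfl
    rw [hsum, ContinuousAlternatingMap.add_apply, hP q (R q φ) J, hRx]
    · simp
    · by_cases hm : m ∈ range J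
      · right
        intro y
        obtain ⟨m', hm', hJ'⟩ := hJ
        have hm's : m' ∈ s := (Finset.mem_insert.1 hm').resolve_left fun h ↦ hJ' (h ▸ hm)
        rw [hRx, ContinuousAlternatingMap.sub_apply, hH q φ J ⟨m', hm's, hJ'⟩, sub_self]
      · exact .inl hm

/-- The **Poincaré lemma** for compactly supported forms, below the top degree, with a continuous
homotopy operator. -/
theorem exists_homotopy [FiniteDimensional ℝ E] :
    ∃ H : ∀ q : ℕ, TestForm (⊤ : Opens E) (q + 1) →L[ℂ] TestForm (⊤ : Opens E) q,
      ∀ q φ, q + 1 < Module.finrank ℝ E →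
        dForm ⊤ q (H q φ) + H (q + 1) (dForm ⊤ (q + 1) φ) = φ := by
  let b := Module.finBasis ℝ E
  -- Below the top degree every component misses some basis vector.
  obtain ⟨H, hH⟩ := exists_homotopy_finset b Finset.univ
  refine ⟨H, fun q φ hq ↦ DFunLike.ext _ _ fun x ↦ ?_⟩
  refine ContinuousAlternatingMap.toAlternatingMap_injective (b.ext_alternating fun J _ ↦ ?_)
  have hJ : ∃ m ∈ Finset.univ, m ∉ range J := by
    by_contra! h
    have := Fintype.card_le_of_surjective J fun m ↦ h m (Finset.mem_univ m)
    simp at this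
    omega
  exact hH q φ J hJ x

end Homotopy

/-! ### Currents closed outside a ball -/

section Exterior
universe u
variable {E : Type u} [NormedAddCommGroup E] [NormedSpace ℝ E]

theorem coe_monoCLM_top {k : ℕ} {Ω : Opens E} (φ : TestForm Ω k) :
    ⇑(TestFunction.monoCLM ℂ φ : TestForm (⊤ : Opens E) k) = φ := by
  simp

/-- A current `T` on `E` that is closed outside the closed unit ball is exact there, with a
primitive defined on `E`, if its dimension is at least two and less than the dimension of `E`. The cone
operator `C` produces a current `T ∘ d ∘ C` supported in the closed ball with the same boundary as
`T`, and the transpose of the homotopy operator `H` is a primitive of the difference. -/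
theorem exists_primitive_outside_ball [FiniteDimensional ℝ E] {Ω : Opens E}
    (hΩ : ∀ x, x ∈ Ω ↔ 1 < ‖x‖) {q : ℕ} (hq : q + 2 < Module.finrank ℝ E)
    (T : Current (⊤ : Opens E) (q + 2))
    (hT : ∀ φ : TestForm Ω (q + 1), T (dForm ⊤ (q + 1) (TestFunction.monoCLM ℂ φ)) = 0) :
    ∃ S : Current (⊤ : Opens E) (q + 3), ∀ φ : TestForm Ω (q + 2),
      S (dForm ⊤ (q + 2) (TestFunction.monoCLM ℂ φ)) = T (TestFunction.monoCLM ℂ φ) := by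
  obtain ⟨C, hC0, hC⟩ := exists_cone_clm (E := E)
  obtain ⟨H, hH⟩ := exists_homotopy (E := E)
  -- A test form that vanishes on a neighbourhood of the closed ball is a test form on `Ω`.
  have hT' (φ : TestForm (⊤ : Opens E) (q + 1)) (r : ℝ) (hr : 1 < r)
      (hφ : ∀ x ∈ Metric.ball 0 r, φ x = 0) : T (dForm ⊤ (q + 1) φ) = 0 := by
    have hsupp : tsupport φ ⊆ (Metric.ball 0 r)ᶜ :=
      closure_minimal (fun x hx hxr ↦ hx (hφ x hxr)) Metric.isOpen_ball.isClosed_compl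
    have hsub : tsupport φ ⊆ Ω := fun x hx ↦ (hΩ x).2 <| hr.trans_le <|
      not_lt.1 fun h ↦ hsupp hx (mem_ball_zero_iff.2 h)
    rw [← hT ⟨φ, φ.contDiff, φ.hasCompactSupport, hsub⟩]
    congr 2
    exact DFunLike.ext' (coe_monoCLM_top
      (⟨φ, φ.contDiff, φ.hasCompactSupport, hsub⟩ : TestForm Ω (q + 1))).symm
  -- `W` differs from `T` by a current supported in the closed ball, and is closed on all of `E`.
  let W : Current (⊤ : Opens E) (q + 2) := T - T ∘L dForm ⊤ (q + 1) ∘L C (q + 1)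
  have hWd (ψ : TestForm (⊤ : Opens E) (q + 1)) : W (dForm ⊤ (q + 1) ψ) = 0 := by
    have := hT' (ψ - dForm ⊤ q (C q ψ) - C (q + 1) (dForm ⊤ (q + 1) ψ)) 2 one_lt_two
      fun x hx ↦ by
        rw [sub_sub, _root_.sub_apply, _root_.add_apply, hC q ψ x hx, sub_self]
    rwa [map_sub, map_sub, map_sub, dForm_dForm, sub_zero] at this
  refine ⟨W ∘L H (q + 2), fun φ ↦ ?_⟩
  obtain ⟨r, hr, hφ⟩ : ∃ r : ℝ, 1 < r ∧ ∀ x ∈ Metric.ball 0 r, φ x = 0 := by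
    rcases (tsupport φ).eq_empty_or_nonempty with h | h
    · exact ⟨2, one_lt_two, fun x _ ↦ image_eq_zero_of_notMem_tsupport (h ▸ notMem_empty x)⟩
    · obtain ⟨y, hy, hmin⟩ := φ.hasCompactSupport.isCompact.exists_isMinOn h
        continuous_norm.continuousOn
      exact ⟨‖y‖, (hΩ y).1 (φ.tsupport_subset hy), fun x hx ↦ image_eq_zero_of_notMem_tsupport
        fun h ↦ (mem_ball_zero_iff.1 hx).not_ge (hmin h)⟩
  set ψ : TestForm (⊤ : Opens E) (q + 2) := TestFunction.monoCLM ℂ φ with hψ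
  have hψ0 : ∀ x ∈ Metric.ball 0 r, ψ x = 0 := by
    rw [hψ, coe_monoCLM_top]
    exact hφ
  have h1 : H (q + 2) (dForm ⊤ (q + 2) ψ) = ψ - dForm ⊤ (q + 1) (H (q + 1) ψ) :=
    eq_sub_of_add_eq' (hH (q + 1) ψ hq)
  have h2 : W ψ = T ψ - T (dForm ⊤ (q + 1) (C (q + 1) ψ)) := rfl
  rw [ContinuousLinearMap.comp_apply, h1, map_sub, hWd, sub_zero, h2,
    hT' _ r hr (hC0 (q + 1) ψ r hψ0), sub_zero]

end Exterior

/-- The signs in `dCurrent` only rescale the primitive. -/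
theorem exists_extendable_primitive {n j k : ℕ} (hj : 2 ≤ j) (hj' : j + 2 ≤ 2 * n)
    (hk : j + (k + 1) = 2 * n) (T : Current (ballCompl n) (k + 1))
    (hT : T ∈ extendable (ballCompl n) (k + 1)) (hdT : dCurrent (ballCompl n) k T = 0) :
    ∃ S : Current (ballCompl n) (k + 1 + 1), S ∈ extendable (ballCompl n) (k + 1 + 1) ∧
      dCurrent (ballCompl n) (k + 1) S = T := by
  obtain ⟨T, rfl⟩ := hT
  obtain ⟨q, rfl⟩ : ∃ q, k = q + 1 := ⟨k - 1, by omega⟩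
  have hsign (i : ℕ) : (-1 : ℂ) ^ i ≠ 0 := pow_ne_zero _ (by norm_num)
  obtain ⟨S, hS⟩ := exists_primitive_outside_ball (Ω := ballCompl n) (q := q)
    (fun x ↦ by simp [ballCompl]) (by
      rw [finrank_real_of_complex, finrank_euclideanSpace_fin]
      omega) T fun φ ↦ by
      rw [dCurrent_restrict] at hdT
      have : (-1 : ℂ) ^ (q + 1) * T (dForm ⊤ (q + 1) (TestFunction.monoCLM ℂ φ)) = 0 :=
        DFunLike.congr_fun hdT φ
      exact (mul_eq_zero.1 this).resolve_left (hsign _)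
  refine ⟨_, ⟨((-1 : ℂ) ^ (q + 2))⁻¹ • S, rfl⟩, ?_⟩
  rw [dCurrent_restrict, map_smul, map_smul]
  ext φ
  change ((-1 : ℂ) ^ (q + 2))⁻¹ * ((-1 : ℂ) ^ (q + 2) *
    S (dForm ⊤ (q + 2) (TestFunction.monoCLM ℂ φ))) = T (TestFunction.monoCLM ℂ φ)
  rw [inv_mul_cancel_left₀ (hsign _), hS]

end ExtendableCurrents
end

theorem mainTheorem1 (n j : ℕ) (hj : 2 ≤ j) (hj' : j + 2 ≤ 2 * n) :
    Subsingleton (ExtendableCurrents.Cohomology n j) ∧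
      ∀ k : ℕ, j + (k + 1) = 2 * n →
        ∀ T : ExtendableCurrents.Current (ExtendableCurrents.ballCompl n) (k + 1),
          T ∈ ExtendableCurrents.extendable (ExtendableCurrents.ballCompl n) (k + 1) →
          ExtendableCurrents.dCurrent (ExtendableCurrents.ballCompl n) k T = 0 →
          ∃ S : ExtendableCurrents.Current (ExtendableCurrents.ballCompl n) (k + 1 + 1),
            S ∈ ExtendableCurrents.extendable (ExtendableCurrents.ballCompl n) (k + 1 + 1) ∧
            ExtendableCurrents.dCurrent (ExtendableCurrents.ballCompl n) (k + 1) S = T := by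
  refine ⟨?_, fun k hk T hT hdT ↦
    ExtendableCurrents.exists_extendable_primitive hj hj' hk T hT hdT⟩
  obtain ⟨k, hk⟩ : ∃ k, 2 * n - j = k + 1 := ⟨2 * n - j - 1, by omega⟩
  rw [ExtendableCurrents.Cohomology, hk, Submodule.Quotient.subsingleton_iff,
    Submodule.submoduleOf_eq_top]
  rintro T ⟨hT, hdT⟩
  obtain ⟨S, hS, hST⟩ := ExtendableCurrents.exists_extendable_primitive hj hj' (by omega) T hT
    (LinearMap.mem_ker.1 hdT)
  exact ⟨S, hS, hST⟩
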